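/- Let $0<\alpha,\beta<1$, $n\in\mathbb N$, $w(x)=(1-x)^{\alpha}(1+x)^{\beta}$ and $$\ell[f](x)=-\frac{1}{(1-x)^{\alpha}(1+x)^{\beta}}\left[(1-x)^{\alpha+1}(1+x)^{\beta+1}f'(x)\right]',\qquad x\in(-1,1),$$ and let $\ell^n$ be the composition of $\ell$ with itself $n$ times. The maximal domain of $\ell^n$ is $$\mathcal D_{\max}^{n}=\{f:(-1,1)\to\mathbb C \;:\; f,f',\dots,f^{(2n-1)}\in AC_{\rm loc}(-1,1),\ f,\ \ell^n[f]\in L^2((-1,1),w\,dx)\}.$$ Let $a_k(x)=c_k(1-x)^{\alpha+k}(1+x)^{\beta+k}$ for $k=1,\dots,n$, where $c_1,\dots,c_n$ are any real constants (for instance $c_k=1$, or the constants $c_k=C(n,k,\alpha,\beta)$ for which $\ell^n[f]=\frac1w\sum_{k=1}^n(-1)^k[a_kf^{(k)}]^{(k)}$). Define the quasi-derivatives by $f^{[k]}=f^{(k)}$ for $0\le k<n$, $f^{[n]}=a_nf^{(n)}$ and $f^{[n+k]}=a_{n-k}f^{(n-k)}-(f^{[n+k-1]})'$ for $1\le k\le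 n-1$, and the sesquilinear form by $$[f,g]_n(x)=\sum_{k=1}^n\sum_{j=1}^k(-1)^{k+j}\left\{\big[a_k\overline g^{(k)}\big]^{(k-j)}f^{(j-1)}-\big[a_kf^{(k)}\big]^{(k-j)}\overline g^{(j-1)}\right\}(x).$$ For $s=1,\dots,n$ let $\varphi_s^{+}$ be any $C^\infty(-1,1)$ function that equals $(1-x)^{s-1}$ for $x$ near $1$ and $0$ for $x$ near $-1$, and let $\varphi_s^{-}$ be any $C^\infty(-1,1)$ function that equals $0$ for $x$ near $1$ and $(1+x)^{s-1}$ for $x$ near $-1$. Then for every $f\in\mathcal D_{\max}^{n}$ and $s=1,\dots,n$ the one-sided limits $f^{[2n-s]}(\pm1):=\lim_{x\to\pm1}f^{[2n-s]}(x)$ and $[f,\varphi_s^{\pm}]_n(\pm1):=\lim_{x\to\pm1}[f,\varphi_s^{\pm}]_n(x)$, taken from within $(-1,1)$, exist and are finite, and $$f^{[2n-s]}(1)=\frac{(-1)^s}{(s-1)!}[f,\varphi_s^{+}]_n(1),\qquad -f^{[2n-s]}(-1)=\frac{1}{(s-1)!}[f,\varphi_s^{-}]_n(-1).$$ -/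

import Mathlib

open Set Filter Topology MeasureTheory
open scoped ContDiff

namespace JacobiPower

noncomputable section

/-- The weight `(1 - x)^α (1 + x)^β` on `(-1, 1)`. -/
def weight (α β : ℝ) (x : ℝ) : ℝ := (1 - x) ^ α * (1 + x) ^ β

/-- The measure `(1 - x)^α (1 + x)^β dx` on the interval `(-1, 1)`. -/
def weightMeasure (α β : ℝ) : Measure ℝ :=
  (volume.restrict (Ioo (-1) 1)).withDensity fun x => ENNReal.ofReal (weight α β x)

/-- The Jacobi differential expression
`ℓ[f] = - (1-x)^(-α) (1+x)^(-β) ((1-x)^(α+1) (1+x)^(β+1) f')'`.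
Functions on `(-1, 1)` are represented by functions on `ℝ`; on `(-1, 1)` the value of `ℓ[f]`
only depends on the values of `f` on `(-1, 1)`. -/
def jacobiExpr (α β : ℝ) (f : ℝ → ℂ) : ℝ → ℂ := fun x =>
  -((weight α β x : ℂ)⁻¹) * deriv (fun y => (weight (α + 1) (β + 1) y : ℂ) * deriv f y) x

/-- `ℓ^n[f]`: the Jacobi expression composed with itself `n` times. -/
def jacobiPow (α β : ℝ) (n : ℕ) (f : ℝ → ℂ) : ℝ → ℂ := (jacobiExpr α β)^[n] f

/-- Local absolute continuity on `(-1, 1)`: absolute continuity on every compact subinterval. -/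
def ACLoc (f : ℝ → ℂ) : Prop :=
  ∀ a b : ℝ, -1 < a → a ≤ b → b < 1 → AbsolutelyContinuousOnInterval f a b

/-- The maximal domain of the `n`-th power of the Jacobi expression: `f` lies in the weighted
`L²`-space, the derivatives `f', …, f^(2n-1)` exist on `(-1, 1)`, the functions
`f, f', …, f^(2n-1)` are locally absolutely continuous there, and `ℓ^n[f]` lies in the weighted
`L²`-space. -/
structure MaxDomain (α β : ℝ) (n : ℕ) (f : ℝ → ℂ) : Prop where
  memLp : MemLp f 2 (weightMeasure α β)
  differentiableOn : ∀ j : ℕ, j + 1 < 2 * n → DifferentiableOn ℝ (iteratedDeriv j f) (Ioo (-1) 1)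
  acLoc : ∀ j : ℕ, j < 2 * n → ACLoc (iteratedDeriv j f)
  memLp_pow : MemLp (jacobiPow α β n f) 2 (weightMeasure α β)

/-- The quasi-derivatives `f^[0], f^[1], …, f^[2n-1]` attached to a differential expression
`∑ k, (-1)^k (a_k f^(k))^(k)` of order `2n`:
`f^[k] = f^(k)` for `k < n`, `f^[n] = a_n f^(n)`, and
`f^[n+k] = a_(n-k) f^(n-k) - (f^[n+k-1])'` for `1 ≤ k ≤ n - 1`
(so that `n - k = 2n - (n + k)`). -/
def quasiDeriv (a : ℕ → ℝ → ℝ) (n : ℕ) (f : ℝ → ℂ) : ℕ → ℝ → ℂ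
  | 0 => f
  | m + 1 => fun x =>
      if m + 1 < n then iteratedDeriv (m + 1) f x
      else if m + 1 = n then (a n x : ℂ) * iteratedDeriv n f x
      else (a (2 * n - (m + 1)) x : ℂ) * iteratedDeriv (2 * n - (m + 1)) f x
        - deriv (quasiDeriv a n f m) x

/-- The complex conjugate of a function. -/
def conjFun (g : ℝ → ℂ) : ℝ → ℂ := fun x => starRingEnd ℂ (g x)

/-- The sesquilinear form `[f, g]_n(x)` of the expression `∑ k, (-1)^k (a_k f^(k))^(k)`:
`∑_{k=1}^n ∑_{j=1}^k (-1)^(k+j)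
  { (a_k ḡ^(k))^(k-j) f^(j-1) - (a_k f^(k))^(k-j) ḡ^(j-1) }(x)`. -/
def sesqForm (a : ℕ → ℝ → ℝ) (n : ℕ) (f g : ℝ → ℂ) (x : ℝ) : ℂ :=
  ∑ k ∈ Finset.Icc 1 n, ∑ j ∈ Finset.Icc 1 k, (-1 : ℂ) ^ (k + j) *
    (iteratedDeriv (k - j) (fun y => (a k y : ℂ) * iteratedDeriv k (conjFun g) y) x
        * iteratedDeriv (j - 1) f x
      - iteratedDeriv (k - j) (fun y => (a k y : ℂ) * iteratedDeriv k f y) x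
        * iteratedDeriv (j - 1) (conjFun g) x)

/-- The coefficients `a_k(x) = c_k (1-x)^(α+k) (1+x)^(β+k)` of the Lagrangian symmetric form
`(1-x)^(-α) (1+x)^(-β) ∑_{k=1}^n (-1)^k (a_k f^(k))^(k)`.
For the appropriate constants `c_k = C(n, k, α, β)` (the Jacobi-Stirling numbers) this is the
`n`-th power of the Jacobi expression; `c_k = 1` gives the coefficients with the constants
suppressed. -/
def jacobiCoeff (α β : ℝ) (c : ℕ → ℝ) (k : ℕ) (x : ℝ) : ℝ :=
  c k * ((1 - x) ^ (α + k) * (1 + x) ^ (β + k))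

/-- `φ` is a function `φ_j^+`: smooth on `(-1, 1)`, equal to `(1 - x)^(j-1)` near `1` and to `0`
near `-1`. -/
structure IsPhiPlus (j : ℕ) (φ : ℝ → ℂ) : Prop where
  smooth : ContDiffOn ℝ ∞ φ (Ioo (-1) 1)
  near_one : ∀ᶠ x in 𝓝[<] (1 : ℝ), φ x = (1 - (x : ℂ)) ^ (j - 1)
  near_neg_one : ∀ᶠ x in 𝓝[>] (-1 : ℝ), φ x = 0

/-- `φ` is a function `φ_j^-`: smooth on `(-1, 1)`, equal to `0` near `1` and to `(1 + x)^(j-1)`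
near `-1`. -/
structure IsPhiMinus (j : ℕ) (φ : ℝ → ℂ) : Prop where
  smooth : ContDiffOn ℝ ∞ φ (Ioo (-1) 1)
  near_one : ∀ᶠ x in 𝓝[<] (1 : ℝ), φ x = 0
  near_neg_one : ∀ᶠ x in 𝓝[>] (-1 : ℝ), φ x = (1 + (x : ℂ)) ^ (j - 1)

end

end JacobiPower

namespace JacobiPower

/-! Write `w_k = (1-x)^(α+k) (1+x)^(β+k)`. The core is a regularity statement: for `f` in the
maximal domain, every `(w_k f^(k))^(i)` with `i < k ≤ n` extends continuously to `[-1, 1]`. Each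
Lagrangian term is thus controlled separately, so the constants `c_k` are arbitrary and the
expansion of `ℓ^n` in Lagrangian form is never needed.

Regularity (`hasL1Deriv_of_integrableOn_jacobiPow`) is by induction on `n`. The measure is finite,
so `w ℓ^n[f]` is integrable. Since `(w_1 f')' = -w ℓ[f]`, integrability of `w ℓ[f]` makes `w_1 f'`
bounded, and integrating this bound, with `α, β > 0`, makes `w f` bounded. Higher `k` follow from
`(w_(k+1) f^(k+1))' = -w_k (ℓ[f])^(k) + k(k+1+α+β) w_k f^(k)` (`deriv_cweight_succ_mul`), which
trades order in `f` for powers of `ℓ`.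

At the endpoint, `quasiDeriv_eq` unfolds `f^[2n-s]` into a signed sum of the functions `(a_k
f^(k))^(k-s)`, which have limits. In `[f, φ_s]_n`, the terms with `a_k` on `φ_s` tend to zero
(`tendsto_iteratedDeriv_cweight_mul`). In the others `φ_s^(j-1)` tends to zero unless `j = s`, when
its limit is `±(s-1)!`. What remains is the same sum up to this factor. -/

/-! ### The weights `w_k` and their derivatives. -/

/-- The weight `(1 - x)^(α + k) (1 + x)^(β + k)` as a complex-valued function. -/
noncomputable def cweight (α β : ℝ) (k : ℕ) (x : ℝ) : ℂ := (weight (α + k) (β + k) x : ℂ)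

lemma weight_pos {α β x : ℝ} (hx : x ∈ Ioo (-1 : ℝ) 1) : 0 < weight α β x :=
  mul_pos (Real.rpow_pos_of_pos (by linarith [hx.2]) _) (Real.rpow_pos_of_pos (by linarith [hx.1]) _)

lemma cweight_ne_zero {α β : ℝ} {k : ℕ} {x : ℝ} (hx : x ∈ Ioo (-1 : ℝ) 1) :
    cweight α β k x ≠ 0 := by
  simpa [cweight] using (weight_pos hx).ne'

lemma contDiffOn_weight (α β : ℝ) : ContDiffOn ℝ ∞ (weight α β) (Ioo (-1) 1) := by
  unfold weight
  refine ContDiffOn.mul (ContDiffOn.rpow_const_of_ne (by fun_prop) ?_)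
    (ContDiffOn.rpow_const_of_ne (by fun_prop) ?_)
  · intro x hx; linarith [hx.2]
  · intro x hx; linarith [hx.1]

lemma contDiffOn_cweight (α β : ℝ) (k : ℕ) : ContDiffOn ℝ ∞ (cweight α β k) (Ioo (-1) 1) :=
  Complex.ofRealCLM.contDiff.comp_contDiffOn (contDiffOn_weight _ _)

lemma cweight_succ (α β : ℝ) (k : ℕ) {x : ℝ} (hx : x ∈ Ioo (-1 : ℝ) 1) :
    cweight α β (k + 1) x = (1 - (x : ℂ) ^ 2) * cweight α β k x := by
  have h1 : 0 < 1 - x := by linarith [hx.2]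
  have h2 : 0 < 1 + x := by linarith [hx.1]
  unfold cweight weight
  push_cast
  rw [← add_assoc, ← add_assoc, Real.rpow_add_one h1.ne', Real.rpow_add_one h2.ne']
  push_cast
  ring

lemma hasDerivAt_cweight_succ (α β : ℝ) (k : ℕ) {x : ℝ} (hx : x ∈ Ioo (-1 : ℝ) 1) :
    HasDerivAt (cweight α β (k + 1))
      ((β - α - (α + β + 2 + 2 * k) * x) * cweight α β k x) x := by
  have h1 : 0 < 1 - x := by linarith [hx.2]
  have h2 : 0 < 1 + x := by linarith [hx.1]
  have d1 := ((hasDerivAt_id x).const_sub 1).rpow_const (p := α + (k + 1 : ℕ)) (Or.inl h1.ne')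
  have d2 := ((hasDerivAt_id x).const_add 1).rpow_const (p := β + (k + 1 : ℕ)) (Or.inl h2.ne')
  have d := (d1.mul d2).ofReal_comp
  refine d.congr_deriv ?_
  unfold cweight weight
  simp only [id]
  push_cast
  have e1 : α + ((k : ℝ) + 1) - 1 = α + k := by ring
  have e2 : β + ((k : ℝ) + 1) - 1 = β + k := by ring
  rw [e1, e2, ← add_assoc α, ← add_assoc β, Real.rpow_add_one h1.ne', Real.rpow_add_one h2.ne']
  push_cast
  ring

/-! ### Calculus of locally absolutely continuous derivatives. -/

lemma ACLoc.congr {f g : ℝ → ℂ} (hf : ACLoc f) (h : EqOn f g (Ioo (-1) 1)) : ACLoc g := by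
  intro a b ha hab hb
  have hs : uIcc a b ⊆ Ioo (-1 : ℝ) 1 := by
    rw [uIcc_of_le hab]; exact fun x hx => ⟨by linarith [hx.1], by linarith [hx.2]⟩
  have := hf a b ha hab hb
  rw [absolutelyContinuousOnInterval_iff] at this ⊢
  intro ε hε
  obtain ⟨δ, hδ, H⟩ := this ε hε
  refine ⟨δ, hδ, fun E hE hl => ?_⟩
  convert H E hE hl using 3 with i hi
  all_goals
    symm
    apply h
    apply hs
    first
      | exact (hE.1 i hi).1
      | exact (hE.1 i hi).2

lemma ACLoc.mul {f g : ℝ → ℂ} (hf : ACLoc f) (hg : ACLoc g) : ACLoc (fun x => f x * g x) :=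
  fun a b ha hab hb => (hf a b ha hab hb).smul (hg a b ha hab hb)

lemma ACLoc.add {f g : ℝ → ℂ} (hf : ACLoc f) (hg : ACLoc g) : ACLoc (fun x => f x + g x) :=
  fun a b ha hab hb => (hf a b ha hab hb).add (hg a b ha hab hb)

lemma ACLoc.of_contDiffOn {f : ℝ → ℂ} (hf : ContDiffOn ℝ 1 f (Ioo (-1) 1)) : ACLoc f := by
  intro a b ha hab hb
  apply ContDiffOn.absolutelyContinuousOnInterval
  refine hf.mono ?_
  rw [uIcc_of_le hab]; exact fun x hx => ⟨by linarith [hx.1], by linarith [hx.2]⟩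

lemma ACLoc.continuousOn {f : ℝ → ℂ} (hf : ACLoc f) : ContinuousOn f (Ioo (-1) 1) := by
  intro x hx
  have h := (hf ((x - 1) / 2) ((x + 1) / 2) (by linarith [hx.1]) (by linarith)
    (by linarith [hx.2])).continuousOn
  rw [uIcc_of_le (by linarith)] at h
  exact (h.continuousAt (Icc_mem_nhds (by linarith [hx.1]) (by linarith [hx.2]))).continuousWithinAt

lemma eqOn_iteratedDeriv {f g : ℝ → ℂ} (h : EqOn f g (Ioo (-1) 1)) (j : ℕ) :
    EqOn (iteratedDeriv j f) (iteratedDeriv j g) (Ioo (-1) 1) := fun _ hx =>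
  (h.eventuallyEq_of_mem (isOpen_Ioo.mem_nhds hx)).iteratedDeriv_eq j

/-- `f` is `m - 1` times differentiable on `(-1, 1)`, with all these derivatives locally
absolutely continuous. -/
structure ACReg (m : ℕ) (f : ℝ → ℂ) : Prop where
  differentiableOn : ∀ j : ℕ, j + 1 < m → DifferentiableOn ℝ (iteratedDeriv j f) (Ioo (-1) 1)
  acLoc : ∀ j : ℕ, j < m → ACLoc (iteratedDeriv j f)

lemma ACReg.congr {m : ℕ} {f g : ℝ → ℂ} (hf : ACReg m f) (h : EqOn f g (Ioo (-1) 1)) :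
    ACReg m g :=
  ⟨fun j hj => (hf.differentiableOn j hj).congr (eqOn_iteratedDeriv h j).symm,
    fun j hj => (hf.acLoc j hj).congr (eqOn_iteratedDeriv h j)⟩

lemma ACReg.mono {m k : ℕ} {f : ℝ → ℂ} (hf : ACReg m f) (h : k ≤ m) : ACReg k f :=
  ⟨fun j hj => hf.differentiableOn j (by omega), fun j hj => hf.acLoc j (by omega)⟩

lemma ACReg.deriv {m : ℕ} {f : ℝ → ℂ} (hf : ACReg (m + 1) f) : ACReg m (deriv f) := by
  constructor <;> intro j hj <;> rw [← iteratedDeriv_succ']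
  · exact hf.differentiableOn _ (by omega)
  · exact hf.acLoc _ (by omega)

/-- The step starts at order 2 because order 1 gives absolute continuity without differentiability
everywhere. Hence the inductions below have two base cases. -/
lemma ACReg.succ {m : ℕ} {f : ℝ → ℂ} (hd : DifferentiableOn ℝ f (Ioo (-1) 1)) (ha : ACLoc f)
    (hf : ACReg (m + 1) (_root_.deriv f)) : ACReg (m + 2) f := by
  constructor
  · rintro (_ | j) hj
    · simpa using hd
    · rw [iteratedDeriv_succ']; exact hf.differentiableOn j (by omega)
  · rintro (_ | j) hj
    · simpa using ha
    · rw [iteratedDeriv_succ']; exact hf.acLoc j (by omega)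

lemma acReg_zero (f : ℝ → ℂ) : ACReg 0 f := ⟨fun _ h => by omega, fun _ h => by omega⟩

lemma acReg_one {f : ℝ → ℂ} (h : ACLoc f) : ACReg 1 f :=
  ⟨fun _ h => by omega, fun j hj => by obtain rfl : j = 0 := by omega
                                       simpa using h⟩

lemma ACReg.add {m : ℕ} {f g : ℝ → ℂ} (hf : ACReg m f) (hg : ACReg m g) :
    ACReg m (fun x => f x + g x) := by
  induction m using Nat.strong_induction_on generalizing f g with
  | _ m ih =>
    match m, hf, hg with
    | 0, _, _ => exact acReg_zero _
    | 1, hf, hg =>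
      exact acReg_one (by simpa using (hf.acLoc 0 (by omega)).add (hg.acLoc 0 (by omega)))
    | m + 2, hf, hg =>
      have df := hf.differentiableOn 0 (by omega)
      have dg := hg.differentiableOn 0 (by omega)
      simp only [iteratedDeriv_zero] at df dg
      refine ACReg.succ (df.add dg)
        (by simpa using (hf.acLoc 0 (by omega)).add (hg.acLoc 0 (by omega))) ?_
      refine (ih (m + 1) (by omega) hf.deriv hg.deriv).congr fun x hx => ?_
      have hn := isOpen_Ioo.mem_nhds hx
      exact (deriv_fun_add (df.differentiableAt hn) (dg.differentiableAt hn)).symm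

lemma ACReg.smooth_mul {m : ℕ} {f a : ℝ → ℂ} (ha : ContDiffOn ℝ ∞ a (Ioo (-1) 1))
    (hf : ACReg m f) : ACReg m (fun x => a x * f x) := by
  induction m using Nat.strong_induction_on generalizing f a with
  | _ m ih =>
    have aca : ACLoc a := .of_contDiffOn (ha.of_le (by exact_mod_cast le_top))
    match m, hf with
    | 0, _ => exact acReg_zero _
    | 1, hf => exact acReg_one (by simpa using aca.mul (hf.acLoc 0 (by omega)))
    | m + 2, hf =>
      have df := hf.differentiableOn 0 (by omega)
      have acf := hf.acLoc 0 (by omega)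
      simp only [iteratedDeriv_zero] at df acf
      have da : DifferentiableOn ℝ a (Ioo (-1) 1) := ha.differentiableOn (by simp)
      have ha' : ContDiffOn ℝ ∞ (_root_.deriv a) (Ioo (-1) 1) :=
        ((contDiffOn_infty_iff_deriv_of_isOpen isOpen_Ioo).1 ha).2
      refine ACReg.succ (da.mul df) (aca.mul acf) ?_
      refine ((ih (m + 1) (by omega) ha' (hf.mono (by omega))).add
        (ih (m + 1) (by omega) ha hf.deriv)).congr fun x hx => ?_
      have hn := isOpen_Ioo.mem_nhds hx
      exact (deriv_fun_mul (da.differentiableAt hn) (df.differentiableAt hn)).symm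

lemma ACReg.contDiffOn {m : ℕ} {f : ℝ → ℂ} (hf : ACReg (m + 1) f) :
    ContDiffOn ℝ m f (Ioo (-1) 1) := by
  induction m generalizing f with
  | zero =>
    have := (hf.acLoc 0 (by omega)).continuousOn
    simpa [contDiffOn_zero] using this
  | succ m ih =>
    have df := hf.differentiableOn 0 (by omega)
    simp only [iteratedDeriv_zero] at df
    push_cast
    rw [contDiffOn_succ_iff_deriv_of_isOpen isOpen_Ioo]
    exact ⟨df, by simp, ih hf.deriv⟩

lemma jacobiExpr_eq (α β : ℝ) (f : ℝ → ℂ) (x : ℝ) : jacobiExpr α β f x =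
    -(cweight α β 0 x)⁻¹ * deriv (fun y => cweight α β 1 y * deriv f y) x := by
  simp [jacobiExpr, cweight]

lemma ACReg.jacobiExpr {m : ℕ} {f : ℝ → ℂ} (α β : ℝ) (hf : ACReg (m + 2) f) :
    ACReg m (jacobiExpr α β f) := by
  have h := (ACReg.smooth_mul (contDiffOn_cweight α β 1) hf.deriv).deriv
  have h2 : ContDiffOn ℝ ∞ (fun x => -(cweight α β 0 x)⁻¹) (Ioo (-1) 1) :=
    ((contDiffOn_cweight α β 0).inv fun x hx => cweight_ne_zero hx).neg
  exact (ACReg.smooth_mul h2 h).congr fun x _ => (jacobiExpr_eq α β f x).symm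

/-! ### Continuous extension to the closed interval and integrable derivatives. -/

/-- `G` agrees on `(-1, 1)` with a function that is continuous on the whole line. -/
def HasContExt (G : ℝ → ℂ) : Prop := ∃ g : ℝ → ℂ, Continuous g ∧ EqOn G g (Ioo (-1) 1)

/-- `G` is, on `(-1, 1)`, the primitive of an integrable function. -/
def HasL1Deriv (G : ℝ → ℂ) : Prop :=
  ∃ h : ℝ → ℂ, IntegrableOn h (Ioo (-1) 1) ∧
    ∀ a ∈ Ioo (-1 : ℝ) 1, ∀ b ∈ Ioo (-1 : ℝ) 1, G b - G a = ∫ x in a..b, h x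

lemma uIcc_subset_Ioo {a b : ℝ} (ha : a ∈ Ioo (-1 : ℝ) 1) (hb : b ∈ Ioo (-1 : ℝ) 1) :
    uIcc a b ⊆ Ioo (-1 : ℝ) 1 := by
  intro x hx
  rw [mem_uIcc] at hx
  rcases hx with h | h
  · exact ⟨by linarith [ha.1], by linarith [hb.2]⟩
  · exact ⟨by linarith [hb.1], by linarith [ha.2]⟩

lemma intervalIntegrable_of_mem {h : ℝ → ℂ} (hh : IntegrableOn h (Ioo (-1) 1)) {a b : ℝ}
    (ha : a ∈ Ioo (-1 : ℝ) 1) (hb : b ∈ Ioo (-1 : ℝ) 1) : IntervalIntegrable h volume a b :=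
  (hh.mono_set (uIcc_subset_Ioo ha hb)).intervalIntegrable

lemma zero_mem_Ioo : (0 : ℝ) ∈ Ioo (-1 : ℝ) 1 := by norm_num

lemma HasL1Deriv.congr {f g : ℝ → ℂ} (hf : HasL1Deriv f) (h : EqOn f g (Ioo (-1) 1)) :
    HasL1Deriv g := by
  obtain ⟨u, hu, hf⟩ := hf
  exact ⟨u, hu, fun a ha b hb => by rw [← h ha, ← h hb, hf a ha b hb]⟩

lemma HasL1Deriv.add {f g : ℝ → ℂ} (hf : HasL1Deriv f) (hg : HasL1Deriv g) :
    HasL1Deriv (fun x => f x + g x) := by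
  obtain ⟨u, hu, hf⟩ := hf
  obtain ⟨v, hv, hg⟩ := hg
  refine ⟨fun x => u x + v x, hu.add hv, fun a ha b hb => ?_⟩
  rw [intervalIntegral.integral_add (intervalIntegrable_of_mem hu ha hb)
    (intervalIntegrable_of_mem hv ha hb), ← hf a ha b hb, ← hg a ha b hb]
  ring

lemma HasL1Deriv.const_mul {f : ℝ → ℂ} (c : ℂ) (hf : HasL1Deriv f) :
    HasL1Deriv (fun x => c * f x) := by
  obtain ⟨u, hu, hf⟩ := hf
  refine ⟨fun x => c * u x, hu.const_mul c, fun a ha b hb => ?_⟩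
  rw [intervalIntegral.integral_const_mul, ← hf a ha b hb]
  ring

lemma HasL1Deriv.hasContExt {f : ℝ → ℂ} (hf : HasL1Deriv f) : HasContExt f := by
  obtain ⟨u, hu, hf⟩ := hf
  have hi : Integrable ((Ioo (-1 : ℝ) 1).indicator u) :=
    (integrable_indicator_iff measurableSet_Ioo).2 hu
  refine ⟨fun x => f 0 + ∫ t in (0 : ℝ)..x, (Ioo (-1 : ℝ) 1).indicator u t,
    continuous_const.add
      (intervalIntegral.continuous_primitive (fun a b => hi.intervalIntegrable) 0), fun x hx => ?_⟩
  have : ∫ t in (0 : ℝ)..x, (Ioo (-1 : ℝ) 1).indicator u t = ∫ t in (0 : ℝ)..x, u t :=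
    intervalIntegral.integral_congr fun t ht =>
      indicator_of_mem (uIcc_subset_Ioo zero_mem_Ioo hx ht) u
  simp only [this, ← hf 0 zero_mem_Ioo x hx]
  ring

lemma HasContExt.of_deriv {f : ℝ → ℂ} (hd : DifferentiableOn ℝ f (Ioo (-1) 1))
    (hf : HasContExt (deriv f)) : HasContExt f := by
  obtain ⟨g, hg, h⟩ := hf
  refine ⟨fun x => f 0 + ∫ t in (0 : ℝ)..x, g t, continuous_const.add
    (intervalIntegral.continuous_primitive (fun a b => hg.intervalIntegrable a b) 0),
    fun x hx => ?_⟩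
  have := intervalIntegral.integral_eq_sub_of_hasDerivAt (f := f) (f' := g) (a := 0) (b := x)
    (fun t ht => by
      have ht := uIcc_subset_Ioo zero_mem_Ioo hx ht
      rw [← h ht]
      exact (hd.differentiableAt (isOpen_Ioo.mem_nhds ht)).hasDerivAt) (hg.intervalIntegrable 0 x)
  simp [this]

lemma HasContExt.bounded {f : ℝ → ℂ} (hf : HasContExt f) :
    ∃ C : ℝ, ∀ x ∈ Ioo (-1 : ℝ) 1, ‖f x‖ ≤ C := by
  obtain ⟨g, hg, h⟩ := hf
  obtain ⟨C, hC⟩ := (isCompact_Icc (a := (-1 : ℝ)) (b := 1)).exists_bound_of_continuousOn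
    hg.continuousOn
  exact ⟨C, fun x hx => by rw [h hx]; exact hC x (Ioo_subset_Icc_self hx)⟩

lemma AbsolutelyContinuousOnInterval.comp_lipschitz {f : ℝ → ℂ} {a b : ℝ} {φ : ℂ → ℝ}
    (hf : AbsolutelyContinuousOnInterval f a b) (hφ : ∀ x y, dist (φ x) (φ y) ≤ dist x y) :
    AbsolutelyContinuousOnInterval (fun x => φ (f x)) a b := by
  rw [absolutelyContinuousOnInterval_iff] at hf ⊢
  intro ε hε
  obtain ⟨δ, hδ, H⟩ := hf ε hε
  exact ⟨δ, hδ, fun E hE hl => (Finset.sum_le_sum fun i _ => hφ _ _).trans_lt (H E hE hl)⟩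

lemma AbsolutelyContinuousOnInterval.integral_deriv_eq_sub_complex {f : ℝ → ℂ} {a b : ℝ}
    (hf : AbsolutelyContinuousOnInterval f a b) (hi : IntervalIntegrable (deriv f) volume a b) :
    ∫ x in a..b, deriv f x = f b - f a := by
  have hre : AbsolutelyContinuousOnInterval (fun x => (f x).re) a b :=
    comp_lipschitz hf fun x y => by
      rw [Real.dist_eq, dist_eq_norm, ← Complex.sub_re]; exact Complex.abs_re_le_norm _
  have him : AbsolutelyContinuousOnInterval (fun x => (f x).im) a b :=
    comp_lipschitz hf fun x y => by
      rw [Real.dist_eq, dist_eq_norm, ← Complex.sub_im]; exact Complex.abs_im_le_norm _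
  -- Needed to identify the real and imaginary parts of `deriv f` with the derivatives of the parts,
  -- since `deriv f` is zero wherever `f` fails to be differentiable.
  have hd : ∀ᵐ x, x ∈ uIcc a b → DifferentiableAt ℝ f x := by
    filter_upwards [hre.ae_differentiableAt, him.ae_differentiableAt] with x h1 h2 hx
    have := ((h1 hx).hasDerivAt.ofReal_comp).add ((h2 hx).hasDerivAt.ofReal_comp.mul_const Complex.I)
    refine (this.congr_of_eventuallyEq (f₁ := f) ?_).differentiableAt
    exact Eventually.of_forall fun y => by simp [Complex.re_add_im]
  apply Complex.ext
  · have h1 := Complex.reCLM.intervalIntegral_comp_comm hi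
    simp only [Complex.reCLM_apply] at h1
    rw [← h1, Complex.sub_re, ← hre.integral_deriv_eq_sub]
    apply intervalIntegral.integral_congr_ae
    filter_upwards [hd] with x hx h
    exact (Complex.reCLM.hasFDerivAt.comp_hasDerivAt x
      (hx (uIoc_subset_uIcc h)).hasDerivAt).deriv.symm
  · have h1 := Complex.imCLM.intervalIntegral_comp_comm hi
    simp only [Complex.imCLM_apply] at h1
    rw [← h1, Complex.sub_im, ← him.integral_deriv_eq_sub]
    apply intervalIntegral.integral_congr_ae
    filter_upwards [hd] with x hx h
    exact (Complex.imCLM.hasFDerivAt.comp_hasDerivAt x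
      (hx (uIoc_subset_uIcc h)).hasDerivAt).deriv.symm

lemma ACLoc.hasL1Deriv {f : ℝ → ℂ} (hf : ACLoc f) (hi : IntegrableOn (deriv f) (Ioo (-1) 1)) :
    HasL1Deriv f := by
  refine ⟨deriv f, hi, fun a ha b hb => ?_⟩
  have hii := intervalIntegrable_of_mem hi ha hb
  refine (AbsolutelyContinuousOnInterval.integral_deriv_eq_sub_complex ?_ hii).symm
  rcases le_total a b with h | h
  · exact hf a b ha.1 h hb.2
  · exact (hf b a hb.1 h ha.2).symm

/-! ### Growth at the endpoints: from `w_1 f'` to `w f`. -/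

/-- Mean value inequality against the majorant `‖g 0‖ + (C/γ)(1-x)^(-γ)`, whose derivative is
exactly the assumed bound. -/
lemma norm_le_of_norm_deriv_le_rpow {g : ℝ → ℂ} {γ C : ℝ} (hγ : 0 < γ)
    (hd : ∀ x ∈ Ico (0 : ℝ) 1, DifferentiableAt ℝ g x)
    (hC : ∀ x ∈ Ico (0 : ℝ) 1, ‖deriv g x‖ ≤ C * (1 - x) ^ (-γ - 1)) {x : ℝ}
    (hx : x ∈ Ico (0 : ℝ) 1) : ‖g x‖ ≤ ‖g 0‖ + C / γ * (1 - x) ^ (-γ) := by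
  have hC0 : 0 ≤ C := by
    have := (norm_nonneg _).trans (hC 0 (by norm_num))
    simpa using this
  have hm : ∀ y ∈ Icc (0 : ℝ) x, y ∈ Ico (0 : ℝ) 1 := fun y hy => ⟨hy.1, hy.2.trans_lt hx.2⟩
  have hB : ∀ y ∈ Icc (0 : ℝ) x, HasDerivAt (fun y => ‖g 0‖ + C / γ * (1 - y) ^ (-γ))
      (C * (1 - y) ^ (-γ - 1)) y := fun y hy => by
    have h1 : 0 < 1 - y := by linarith [(hm y hy).2]
    have := ((((hasDerivAt_id y).const_sub 1).rpow_const (p := -γ) (Or.inl h1.ne')).const_mul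
      (C / γ)).const_add ‖g 0‖
    refine this.congr_deriv ?_
    simp only [id]
    field_simp
  refine image_norm_le_of_norm_deriv_right_le_deriv_boundary' (f := g) (f' := deriv g)
    (a := 0) (b := x) (fun y hy => (hd y (hm y hy)).continuousAt.continuousWithinAt)
    (fun y hy => (hd y (hm y (Ico_subset_Icc_self hy))).hasDerivAt.hasDerivWithinAt)
    (B := fun y => ‖g 0‖ + C / γ * (1 - y) ^ (-γ)) (B' := fun y => C * (1 - y) ^ (-γ - 1)) ?_
    (fun y hy => (hB y hy).continuousAt.continuousWithinAt)
    (fun y hy => (hB y (Ico_subset_Icc_self hy)).hasDerivWithinAt)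
    (fun y hy => hC y (hm y (Ico_subset_Icc_self hy))) ⟨hx.1, le_rfl⟩
  simp only [sub_zero, Real.one_rpow, mul_one]
  have := div_nonneg hC0 hγ.le
  linarith

lemma weight_mul_norm_le_of_right {α β C : ℝ} (hα : 0 < α) (hβ : 0 < β) {g : ℝ → ℂ}
    (hd : ∀ x ∈ Ico (0 : ℝ) 1, DifferentiableAt ℝ g x)
    (hC : ∀ x ∈ Ico (0 : ℝ) 1, weight (α + 1) (β + 1) x * ‖deriv g x‖ ≤ C) {x : ℝ}
    (hx : x ∈ Ico (0 : ℝ) 1) : weight α β x * ‖g x‖ ≤ 2 ^ β * (‖g 0‖ + C / α) := by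
  have key := norm_le_of_norm_deriv_le_rpow (g := g) (C := C) hα hd (fun y hy => by
    have h1 : 0 < 1 - y := by linarith [hy.2]
    have h2 : 1 ≤ 1 + y := by linarith [hy.1]
    have h3 : 1 ≤ (1 + y) ^ (β + 1) := Real.one_le_rpow h2 (by linarith)
    have h4 := hC y hy
    have h5 : 0 < (1 - y) ^ (α + 1) := Real.rpow_pos_of_pos h1 _
    have e : (1 - y) ^ (-α - 1) = ((1 - y) ^ (α + 1))⁻¹ := by
      rw [← Real.rpow_neg h1.le]; ring_nf
    rw [e, ← div_eq_mul_inv, le_div_iff₀ h5]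
    refine le_trans ?_ h4
    unfold weight
    have : 0 ≤ ‖deriv g y‖ * (1 - y) ^ (α + 1) := by positivity
    nlinarith) hx
  have h1 : 0 < 1 - x := by linarith [hx.2]
  have h5 : 0 < (1 - x) ^ α := Real.rpow_pos_of_pos h1 _
  have h6 : (1 - x) ^ α ≤ 1 := Real.rpow_le_one h1.le (by linarith [hx.1]) hα.le
  have h7 : (1 + x) ^ β ≤ 2 ^ β :=
    Real.rpow_le_rpow (by linarith [hx.1]) (by linarith [hx.2]) hβ.le
  have h8 : 0 ≤ (1 + x) ^ β := Real.rpow_nonneg (by linarith [hx.1]) _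
  rw [Real.rpow_neg h1.le] at key
  have h9 : (1 - x) ^ α * ‖g x‖ ≤ ‖g 0‖ + C / α :=
    calc _ ≤ (1 - x) ^ α * (‖g 0‖ + C / α * ((1 - x) ^ α)⁻¹) := by gcongr
      _ = (1 - x) ^ α * ‖g 0‖ + C / α := by field_simp
      _ ≤ _ := by nlinarith [norm_nonneg (g 0)]
  calc weight α β x * ‖g x‖ = (1 + x) ^ β * ((1 - x) ^ α * ‖g x‖) := by unfold weight; ring
    _ ≤ _ := mul_le_mul h7 h9 (by positivity) (by positivity)

lemma weight_neg (α β x : ℝ) : weight β α (-x) = weight α β x := by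
  unfold weight; rw [sub_neg_eq_add, ← sub_eq_add_neg, mul_comm]

lemma norm_cweight {α β : ℝ} {k : ℕ} {x : ℝ} (hx : x ∈ Ioo (-1 : ℝ) 1) :
    ‖cweight α β k x‖ = weight (α + k) (β + k) x := by
  rw [cweight, Complex.norm_real, Real.norm_of_nonneg (weight_pos hx).le]

lemma cweight_mul_bounded {α β : ℝ} (hα : 0 < α) (hβ : 0 < β) {f : ℝ → ℂ}
    (hd : DifferentiableOn ℝ f (Ioo (-1) 1))
    (hf : HasContExt (fun x => cweight α β 1 x * deriv f x)) :
    ∃ C : ℝ, ∀ x ∈ Ioo (-1 : ℝ) 1, ‖cweight α β 0 x * f x‖ ≤ C := by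
  obtain ⟨C, hC⟩ := hf.bounded
  have hC' : ∀ x ∈ Ioo (-1 : ℝ) 1, weight (α + 1) (β + 1) x * ‖deriv f x‖ ≤ C := fun x hx => by
    have := hC x hx
    rwa [norm_mul, norm_cweight hx, Nat.cast_one] at this
  have hd' : ∀ x ∈ Ioo (-1 : ℝ) 1, DifferentiableAt ℝ f x := fun x hx =>
    hd.differentiableAt (isOpen_Ioo.mem_nhds hx)
  refine ⟨max (2 ^ β * (‖f 0‖ + C / α)) (2 ^ α * (‖f 0‖ + C / β)), fun x hx => ?_⟩
  rw [norm_mul, norm_cweight hx, Nat.cast_zero, add_zero, add_zero]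
  rcases le_total 0 x with h | h
  · exact (weight_mul_norm_le_of_right hα hβ
      (fun y hy => hd' y ⟨by linarith [hy.1], hy.2⟩)
      (fun y hy => hC' y ⟨by linarith [hy.1], hy.2⟩) ⟨h, hx.2⟩).trans (le_max_left _ _)
  -- The left half reduces to the right half by the reflection `x ↦ -x`, which exchanges `α` and
  -- `β`.
  · have hm : ∀ y ∈ Ico (0 : ℝ) 1, -y ∈ Ioo (-1 : ℝ) 1 := fun y hy =>
      ⟨by linarith [hy.2], by linarith [hy.1]⟩
    have := weight_mul_norm_le_of_right hβ hα (g := fun y => f (-y)) (C := C) (x := -x)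
      (fun y hy => (hd' (-y) (hm y hy)).comp y differentiableAt_id.neg)
      (fun y hy => by
        rw [deriv_comp_neg, norm_neg, ← weight_neg]
        exact hC' _ (hm y hy)) ⟨by linarith, by linarith [hx.1]⟩
    simp only [neg_neg, neg_zero, weight_neg] at this
    exact this.trans (le_max_right _ _)

lemma integrableOn_of_bounded {f : ℝ → ℂ} (hf : ContinuousOn f (Ioo (-1) 1)) {C : ℝ}
    (hC : ∀ x ∈ Ioo (-1 : ℝ) 1, ‖f x‖ ≤ C) : IntegrableOn f (Ioo (-1) 1) :=
  IntegrableOn.of_bound (by simp) (hf.aestronglyMeasurable measurableSet_Ioo) C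
    ((ae_restrict_iff' measurableSet_Ioo).2 (Eventually.of_forall hC))

lemma hasL1Deriv_of_integrableOn_jacobiExpr {α β : ℝ} {f : ℝ → ℂ} (hf : ACReg 2 f)
    (hi : IntegrableOn (fun x => cweight α β 0 x * jacobiExpr α β f x) (Ioo (-1) 1)) :
    HasL1Deriv (fun x => cweight α β 1 x * deriv f x) := by
  have h1 := (ACReg.smooth_mul (contDiffOn_cweight α β 1) hf.deriv).acLoc 0 (by omega)
  simp only [iteratedDeriv_zero] at h1
  refine h1.hasL1Deriv (hi.neg.congr_fun (fun x hx => ?_) measurableSet_Ioo)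
  have := cweight_ne_zero (α := α) (β := β) (k := 0) hx
  simp only [Pi.neg_apply, jacobiExpr_eq]
  field_simp

lemma integrableOn_cweight_mul {α β : ℝ} (hα : 0 < α) (hβ : 0 < β) {f : ℝ → ℂ}
    (hf : ACReg 2 f) (h : HasL1Deriv (fun x => cweight α β 1 x * deriv f x)) :
    IntegrableOn (fun x => cweight α β 0 x * f x) (Ioo (-1) 1) := by
  have hd := hf.differentiableOn 0 (by omega)
  simp only [iteratedDeriv_zero] at hd
  obtain ⟨C, hC⟩ := cweight_mul_bounded hα hβ hd h.hasContExt
  exact integrableOn_of_bounded ((contDiffOn_cweight α β 0).continuousOn.mul hd.continuousOn) hC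

/-! ### Commuting derivatives past the Jacobi expression. -/

lemma contDiffOn_iteratedDeriv {f : ℝ → ℂ} {m k : ℕ}
    (hf : ContDiffOn ℝ (m + k : ℕ) f (Ioo (-1) 1)) :
    ContDiffOn ℝ m (iteratedDeriv k f) (Ioo (-1) 1) := by
  induction k generalizing m with
  | zero => simpa using hf
  | succ k ih =>
    have := ih (m := m + 1) (by rwa [add_right_comm])
    push_cast at this
    rw [contDiffOn_succ_iff_deriv_of_isOpen isOpen_Ioo] at this
    rw [iteratedDeriv_succ]
    exact this.2.2

lemma hasDerivAt_iteratedDeriv {f : ℝ → ℂ} {m j : ℕ} (hf : ContDiffOn ℝ m f (Ioo (-1) 1))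
    (hj : j < m) {x : ℝ} (hx : x ∈ Ioo (-1 : ℝ) 1) :
    HasDerivAt (iteratedDeriv j f) (iteratedDeriv (j + 1) f x) x := by
  have h := contDiffOn_iteratedDeriv (m := 1) (k := j) (hf.of_le (by norm_cast; omega))
  rw [iteratedDeriv_succ]
  exact ((h.differentiableOn (by simp)).differentiableAt (isOpen_Ioo.mem_nhds hx)).hasDerivAt

/-- The coefficients of `ℓ` are polynomials of degree at most 2 and 1, so differentiation preserves
its shape: `(ℓ[f])^(k)` is the Jacobi expression with parameters `α+k, β+k` applied to `f^(k)`, plus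
a multiple of `f^(k)`. -/
lemma iteratedDeriv_jacobiExpr {α β : ℝ} {f : ℝ → ℂ} {k : ℕ}
    (hf : ContDiffOn ℝ (k + 2 : ℕ) f (Ioo (-1) 1)) {x : ℝ} (hx : x ∈ Ioo (-1 : ℝ) 1) :
    iteratedDeriv k (jacobiExpr α β f) x =
      -((1 - (x : ℂ) ^ 2) * iteratedDeriv (k + 2) f x
        + (β - α - (α + β + 2 + 2 * k) * x) * iteratedDeriv (k + 1) f x)
      + k * (k + 1 + α + β) * iteratedDeriv k f x := by
  induction k generalizing x with
  | zero =>
    have h0 := cweight_ne_zero (α := α) (β := β) (k := 0) hx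
    have h1 := (hasDerivAt_cweight_succ α β 0 hx).mul (hasDerivAt_iteratedDeriv hf
      (j := 1) (by omega) hx)
    simp only [iteratedDeriv_one] at h1
    have h2 : deriv (fun y => cweight α β 1 y * deriv f y) x = _ := h1.deriv
    rw [iteratedDeriv_zero, jacobiExpr_eq, h2, cweight_succ α β 0 hx]
    simp only [zero_add, iteratedDeriv_one, Nat.cast_zero]
    field_simp
    ring_nf
  | succ k ih =>
    have hf' : ContDiffOn ℝ (k + 2 : ℕ) f (Ioo (-1) 1) := hf.of_le (by norm_cast; omega)
    rw [iteratedDeriv_succ]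
    have he : iteratedDeriv k (jacobiExpr α β f) =ᶠ[𝓝 x] fun x : ℝ =>
        -((1 - (x : ℂ) ^ 2) * iteratedDeriv (k + 2) f x
        + (β - α - (α + β + 2 + 2 * k) * x) * iteratedDeriv (k + 1) f x)
        + k * (k + 1 + α + β) * iteratedDeriv k f x := by
      filter_upwards [isOpen_Ioo.mem_nhds hx] with y hy using ih hf' hy
    have d0 := hasDerivAt_iteratedDeriv hf (j := k) (by omega) hx
    have d1 := hasDerivAt_iteratedDeriv hf (j := k + 1) (by omega) hx
    have d2 := hasDerivAt_iteratedDeriv hf (j := k + 2) (by omega) hx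
    have dx : HasDerivAt (fun y : ℝ => (y : ℂ)) 1 x := Complex.ofRealCLM.hasDerivAt
    have := ((((dx.pow 2).const_sub 1).mul d2).add
      (((dx.const_mul ((α : ℂ) + β + 2 + 2 * k)).const_sub ((β : ℂ) - α)).mul d1)).neg.add
      (d0.const_mul ((k : ℂ) * (k + 1 + α + β)))
    rw [he.deriv_eq]
    refine HasDerivAt.deriv (this.congr_deriv ?_)
    simp only [Pi.pow_apply]
    push_cast
    ring_nf

/-- The derivative of `w_(k+1)` is `w_k` times the first-order coefficient of the shifted
expression, so `w_k` turns that expression into divergence form. -/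
lemma deriv_cweight_succ_mul {α β : ℝ} {f : ℝ → ℂ} {k : ℕ}
    (hf : ContDiffOn ℝ (k + 2 : ℕ) f (Ioo (-1) 1)) {x : ℝ} (hx : x ∈ Ioo (-1 : ℝ) 1) :
    deriv (fun y => cweight α β (k + 1) y * iteratedDeriv (k + 1) f y) x =
      (-1) * (cweight α β k x * iteratedDeriv k (jacobiExpr α β f) x)
      + k * (k + 1 + α + β) * (cweight α β k x * iteratedDeriv k f x) := by
  have d := (hasDerivAt_cweight_succ α β k hx).mul
    (hasDerivAt_iteratedDeriv hf (j := k + 1) (by omega) hx)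
  have d' : deriv (fun y => cweight α β (k + 1) y * iteratedDeriv (k + 1) f y) x = _ := d.deriv
  rw [d', iteratedDeriv_jacobiExpr hf hx, cweight_succ α β k hx]
  ring

lemma contDiffOn_cweight_mul {α β : ℝ} {f : ℝ → ℂ} {m k : ℕ} (l : ℕ)
    (hf : ContDiffOn ℝ (m + k : ℕ) f (Ioo (-1) 1)) :
    ContDiffOn ℝ m (fun x => cweight α β l x * iteratedDeriv k f x) (Ioo (-1) 1) :=
  ((contDiffOn_cweight α β l).of_le (by exact_mod_cast le_top)).mul (contDiffOn_iteratedDeriv hf)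

lemma iteratedDeriv_cweight_succ_mul {α β : ℝ} {f : ℝ → ℂ} {k : ℕ}
    (hf : ContDiffOn ℝ (2 * k + 3 : ℕ) f (Ioo (-1) 1))
    (hℓ : ContDiffOn ℝ (2 * k + 1 : ℕ) (jacobiExpr α β f) (Ioo (-1) 1)) {x : ℝ}
    (hx : x ∈ Ioo (-1 : ℝ) 1) :
    iteratedDeriv (k + 1) (fun y => cweight α β (k + 2) y * iteratedDeriv (k + 2) f y) x =
      (-1) * iteratedDeriv k (fun y => cweight α β (k + 1) y *
        iteratedDeriv (k + 1) (jacobiExpr α β f) y) x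
      + (k + 1 : ℕ) * ((k + 1 : ℕ) + 1 + α + β) *
        iteratedDeriv k (fun y => cweight α β (k + 1) y * iteratedDeriv (k + 1) f y) x := by
  have hn := isOpen_Ioo.mem_nhds hx
  rw [iteratedDeriv_succ']
  have he : EqOn (deriv (fun y => cweight α β (k + 2) y * iteratedDeriv (k + 2) f y))
      (fun y => (-1) * (cweight α β (k + 1) y * iteratedDeriv (k + 1) (jacobiExpr α β f) y)
      + (k + 1 : ℕ) * ((k + 1 : ℕ) + 1 + α + β) *
        (cweight α β (k + 1) y * iteratedDeriv (k + 1) f y)) (Ioo (-1) 1) := fun y hy =>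
    deriv_cweight_succ_mul (k := k + 1) (hf.of_le (by norm_cast; omega)) hy
  have c1 := contDiffOn_cweight_mul (α := α) (β := β) (m := k) (k + 1) (f := jacobiExpr α β f)
    (k := k + 1) (hℓ.of_le (by norm_cast; omega))
  have c2 := contDiffOn_cweight_mul (α := α) (β := β) (m := k) (k + 1) (f := f)
    (k := k + 1) (hf.of_le (by norm_cast; omega))
  rw [eqOn_iteratedDeriv he k hx, iteratedDeriv_fun_add
    ((contDiffOn_const.mul c1).contDiffAt hn) ((contDiffOn_const.mul c2).contDiffAt hn),
    iteratedDeriv_const_mul_field, iteratedDeriv_const_mul_field]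

/-! ### Regularity on the maximal domain, by induction on the power. -/

theorem hasL1Deriv_of_integrableOn_jacobiPow {α β : ℝ} (hα : 0 < α) (hβ : 0 < β) (n : ℕ)
    {f : ℝ → ℂ} (hf : ACReg (2 * n) f)
    (hi : IntegrableOn (fun x => cweight α β 0 x * jacobiPow α β n f x) (Ioo (-1) 1)) :
    IntegrableOn (fun x => cweight α β 0 x * f x) (Ioo (-1) 1) ∧
    ∀ k, k < n → HasL1Deriv
      (iteratedDeriv k (fun x => cweight α β (k + 1) x * iteratedDeriv (k + 1) f x)) := by
  induction n generalizing f with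
  | zero => exact ⟨hi, fun k hk => by omega⟩
  | succ n ih =>
    have hℓ : ACReg (2 * n) (jacobiExpr α β f) := ACReg.jacobiExpr α β hf
    -- `ℓ^(n+1)[f]` is by definition `ℓ^n` applied to `ℓ[f]`, so the induction hypothesis is used
    -- for `ℓ[f]`.
    obtain ⟨h1, h2⟩ := ih hℓ hi
    have h3 := hasL1Deriv_of_integrableOn_jacobiExpr (hf.mono (by omega)) h1
    refine ⟨integrableOn_cweight_mul hα hβ (hf.mono (by omega)) h3, fun k hk => ?_⟩
    -- In the recursion for `k + 1`, the `ℓ[f]` term is covered by the outer hypothesis at `k < n`,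
    -- and the `f` term by the inner one at `k`.
    induction k with
    | zero => simpa using h3
    | succ k ihk =>
      have c1 : ContDiffOn ℝ (2 * k + 3 : ℕ) f (Ioo (-1) 1) :=
        ACReg.contDiffOn (hf.mono (by omega))
      have c2 : ContDiffOn ℝ (2 * k + 1 : ℕ) (jacobiExpr α β f) (Ioo (-1) 1) :=
        ACReg.contDiffOn (hℓ.mono (by omega))
      exact (((h2 k (by omega)).const_mul (-1)).add ((ihk (by omega)).const_mul
        ((k + 1 : ℕ) * ((k + 1 : ℕ) + 1 + α + β)))).congr fun x hx =>
          (iteratedDeriv_cweight_succ_mul c1 c2 hx).symm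

/-- All derivatives `(w_k f^(k))^(i)` with `i < k ≤ n` extend continuously to `[-1, 1]`. -/
theorem hasContExt_iteratedDeriv {α β : ℝ} {k i : ℕ} {f : ℝ → ℂ}
    (hf : ContDiffOn ℝ (2 * k + 1 : ℕ) f (Ioo (-1) 1))
    (h : HasL1Deriv (iteratedDeriv k (fun x => cweight α β (k + 1) x * iteratedDeriv (k + 1) f x)))
    (hi : i ≤ k) :
    HasContExt (iteratedDeriv i (fun x => cweight α β (k + 1) x * iteratedDeriv (k + 1) f x)) := by
  -- Descending in `i`: the top derivative `i = k` has an integrable derivative, and each lower one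
  -- is a primitive of a function that extends continuously.
  induction hi using Nat.decreasingInduction with
  | self => exact h.hasContExt
  | of_succ i hi ih =>
    rw [iteratedDeriv_succ] at ih
    refine HasContExt.of_deriv ?_ ih
    have c := contDiffOn_cweight_mul (α := α) (β := β) (m := k) (k + 1) (f := f)
      (k := k + 1) (hf.of_le (by norm_cast; omega))
    exact (contDiffOn_iteratedDeriv (m := 1) (c.of_le (by norm_cast; omega))).differentiableOn
      (by simp)

lemma isFiniteMeasure_weightMeasure {α β : ℝ} (hα : 0 < α) (hβ : 0 < β) :
    IsFiniteMeasure (weightMeasure α β) := by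
  refine isFiniteMeasure_withDensity ?_
  refine ne_of_lt (setLIntegral_lt_top_of_le_nnreal (by simp) ⟨(2 ^ α * 2 ^ β : NNReal), ?_⟩)
  intro x hx
  rw [ENNReal.ofReal_le_iff_le_toReal ENNReal.coe_ne_top]
  simp only [ENNReal.coe_toReal, NNReal.coe_mul, NNReal.coe_rpow, NNReal.coe_ofNat]
  have h1 : 0 ≤ 1 - x := by linarith [hx.2]
  have h2 : 0 ≤ 1 + x := by linarith [hx.1]
  unfold weight
  gcongr <;> linarith

/-- The weighted measure is finite, so `L²` is contained in `L¹`. -/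
lemma integrableOn_of_memLp {α β : ℝ} (hα : 0 < α) (hβ : 0 < β) {g : ℝ → ℂ}
    (hg : MemLp g 2 (weightMeasure α β)) :
    IntegrableOn (fun x => cweight α β 0 x * g x) (Ioo (-1) 1) := by
  have := isFiniteMeasure_weightMeasure hα hβ
  have h : Integrable g (weightMeasure α β) := hg.integrable (by norm_num)
  have hm : Measurable (weight α β) := by unfold weight; fun_prop
  unfold weightMeasure at h
  rw [integrable_withDensity_iff_integrable_smul' (by fun_prop) (by simp)] at h
  refine IntegrableOn.congr_fun h (fun x hx => ?_) measurableSet_Ioo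
  simp [ENNReal.toReal_ofReal (weight_pos hx).le, cweight]

lemma MaxDomain.acReg {α β : ℝ} {n : ℕ} {f : ℝ → ℂ} (hf : MaxDomain α β n f) :
    ACReg (2 * n) f := ⟨hf.differentiableOn, hf.acLoc⟩

theorem MaxDomain.hasContExt {α β : ℝ} (hα : 0 < α) (hβ : 0 < β) {n : ℕ} {f : ℝ → ℂ}
    (hf : MaxDomain α β n f) {k i : ℕ} (hk : k < n) (hi : i ≤ k) :
    HasContExt (iteratedDeriv i (fun x => cweight α β (k + 1) x * iteratedDeriv (k + 1) f x)) :=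
  hasContExt_iteratedDeriv (ACReg.contDiffOn (hf.acReg.mono (by omega)))
    ((hasL1Deriv_of_integrableOn_jacobiPow hα hβ n hf.acReg
      (integrableOn_of_memLp hα hβ hf.memLp_pow)).2 k hk) hi

/-! ### Behaviour at an endpoint `-ε`, where `1 + ε x` is the distance to it. -/

/-- The filter of one-sided neighbourhoods, within `{x | 0 < 1 + ε x}`, of the endpoint `-ε` of
`(-1, 1)`, where `ε = 1` or `ε = -1`. -/
def endFilter (ε : ℝ) : Filter ℝ := 𝓝[{x | 0 < 1 + ε * x}] (-ε)

lemma endFilter_one : endFilter 1 = 𝓝[>] (-1) := by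
  have : {x : ℝ | 0 < 1 + 1 * x} = Ioi (-1) := by
    ext x; simp only [mem_ofPred_eq, mem_Ioi]; constructor <;> intro h <;> linarith
  rw [endFilter, this]

lemma endFilter_neg_one : endFilter (-1) = 𝓝[<] 1 := by
  have : {x : ℝ | 0 < 1 + (-1) * x} = Iio 1 := by
    ext x; simp only [mem_ofPred_eq, mem_Iio]; constructor <;> intro h <;> linarith
  rw [endFilter, this, neg_neg]

lemma endFilter_le (ε : ℝ) : endFilter ε ≤ 𝓝 (-ε) := nhdsWithin_le_nhds

lemma eventually_endFilter_mem {ε : ℝ} (hε : ε = 1 ∨ ε = -1) :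
    ∀ᶠ x in endFilter ε, x ∈ Ioo (-1 : ℝ) 1 := by
  rcases hε with rfl | rfl
  · rw [endFilter_one]; exact Ioo_mem_nhdsGT (by norm_num)
  · rw [endFilter_neg_one]; exact Ioo_mem_nhdsLT (by norm_num)

/-- The half-line is open, so agreement near the endpoint is agreement around each nearby point and
passes to derivatives. -/
lemma eventually_eventually_endFilter {ε : ℝ} {P : ℝ → Prop} (h : ∀ᶠ x in endFilter ε, P x) :
    ∀ᶠ x in endFilter ε, ∀ᶠ y in 𝓝 x, P y := by
  have hopen : IsOpen {x : ℝ | 0 < 1 + ε * x} := isOpen_lt (by fun_prop) (by fun_prop)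
  filter_upwards [eventually_eventually_nhdsWithin.2 h, self_mem_nhdsWithin] with x hx hs
  rwa [hopen.nhdsWithin_eq hs] at hx

lemma eventuallyEq_iteratedDeriv {ε : ℝ} {f g : ℝ → ℂ} (h : f =ᶠ[endFilter ε] g) (j : ℕ) :
    iteratedDeriv j f =ᶠ[endFilter ε] iteratedDeriv j g := by
  filter_upwards [eventually_eventually_endFilter h] with x hx using Filter.EventuallyEq.iteratedDeriv_eq j hx

lemma HasContExt.tendsto {f : ℝ → ℂ} (hf : HasContExt f) {ε : ℝ} (hε : ε = 1 ∨ ε = -1) :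
    ∃ L, Tendsto f (endFilter ε) (𝓝 L) := by
  obtain ⟨g, hg, h⟩ := hf
  refine ⟨g (-ε), ((hg.tendsto _).mono_left (endFilter_le ε)).congr' ?_⟩
  filter_upwards [eventually_endFilter_mem hε] with x hx using (h hx).symm

lemma iteratedDeriv_one_add_mul_pow (ε : ℝ) (r j : ℕ) :
    iteratedDeriv j (fun x : ℝ => (1 + (ε : ℂ) * x) ^ r) =
      fun x : ℝ => (ε : ℂ) ^ j * r.descFactorial j * (1 + (ε : ℂ) * x) ^ (r - j) := by
  induction j with
  | zero => simp
  | succ j ih =>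
    rw [iteratedDeriv_succ, ih]
    ext x
    have dx : HasDerivAt (fun y : ℝ => (y : ℂ)) 1 x := Complex.ofRealCLM.hasDerivAt
    have d := ((((dx.const_mul (ε : ℂ)).const_add 1).fun_pow (r - j)).const_mul
      ((ε : ℂ) ^ j * r.descFactorial j))
    rw [d.deriv, Nat.descFactorial_succ, Nat.sub_sub]
    push_cast
    ring

lemma tendsto_iteratedDeriv_of_eventuallyEq_pow {ε : ℝ} (hε : ε = 1 ∨ ε = -1) {ψ : ℝ → ℂ} {r : ℕ}
    (hψ : ψ =ᶠ[endFilter ε] fun x : ℝ => (1 + (ε : ℂ) * x) ^ r) (j : ℕ) :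
    Tendsto (iteratedDeriv j ψ) (endFilter ε) (𝓝 (if j = r then (ε : ℂ) ^ r * r.factorial else 0)) := by
  have h := eventuallyEq_iteratedDeriv hψ j
  rw [iteratedDeriv_one_add_mul_pow] at h
  refine Tendsto.congr' h.symm ?_
  have hc : Continuous fun x : ℝ => (ε : ℂ) ^ j * r.descFactorial j * (1 + (ε : ℂ) * x) ^ (r - j) := by
    fun_prop
  refine ((hc.tendsto (-ε)).mono_left (endFilter_le ε)).trans (le_of_eq ?_)
  have h0 : 1 + (ε : ℂ) * ((-ε : ℝ) : ℂ) = 0 := by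
    rcases hε with rfl | rfl <;> simp
  rw [h0]
  congr 1
  split_ifs with hj
  · subst hj; simp [Nat.descFactorial_self]
  · rcases lt_or_gt_of_ne hj with hlt | hlt
    · rw [zero_pow (by omega), mul_zero]
    · simp [Nat.descFactorial_of_lt hlt]

/-- Each derivative lowers the singular exponent by one. The cofactor stays smooth on a set that
contains the endpoint `-ε` itself, hence is continuous there. -/
lemma exists_iteratedDeriv_rpow_mul {ε p : ℝ} {h : ℝ → ℝ}
    (hh : ContDiffOn ℝ ∞ h {x | 0 < 1 - ε * x}) (i : ℕ) :
    ∃ g : ℝ → ℝ, ContDiffOn ℝ ∞ g {x | 0 < 1 - ε * x} ∧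
      ∀ x, 0 < 1 + ε * x → 0 < 1 - ε * x →
        iteratedDeriv i (fun y : ℝ => (((1 + ε * y) ^ p * h y : ℝ) : ℂ)) x =
          (((1 + ε * x) ^ (p - i) * g x : ℝ) : ℂ) := by
  have o1 : IsOpen {x : ℝ | 0 < 1 - ε * x} := isOpen_lt (by fun_prop) (by fun_prop)
  have o2 : IsOpen {x : ℝ | 0 < 1 + ε * x} := isOpen_lt (by fun_prop) (by fun_prop)
  induction i with
  | zero => exact ⟨h, hh, by simp⟩
  | succ i ih =>
    obtain ⟨g, hg, H⟩ := ih
    have hg' := (contDiffOn_infty_iff_deriv_of_isOpen o1).1 hg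
    refine ⟨fun x => (p - i) * ε * g x + (1 + ε * x) * deriv g x,
      (contDiffOn_const.mul hg).add (ContDiffOn.mul (by fun_prop) hg'.2), fun x h2 h1 => ?_⟩
    have he : iteratedDeriv i (fun y : ℝ => (((1 + ε * y) ^ p * h y : ℝ) : ℂ)) =ᶠ[𝓝 x]
        fun x => (((1 + ε * x) ^ (p - i) * g x : ℝ) : ℂ) := by
      filter_upwards [o1.mem_nhds h1, o2.mem_nhds h2] with y hy1 hy2 using H y hy2 hy1
    rw [iteratedDeriv_succ, he.deriv_eq]
    have dg := (hg'.1.differentiableAt (o1.mem_nhds h1)).hasDerivAt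
    have dp := (((hasDerivAt_id x).const_mul ε).const_add 1).rpow_const (p := p - i)
      (Or.inl h2.ne')
    have d := (dp.fun_mul dg).ofReal_comp
    simp only [id] at d
    rw [d.deriv]
    congr 1
    have e : p - (i + 1 : ℕ) = p - i - 1 := by push_cast; ring
    have e2 : (1 + ε * x) ^ (p - i) = (1 + ε * x) ^ (p - i - 1) * (1 + ε * x) := by
      rw [← Real.rpow_add_one h2.ne', sub_add_cancel]
    rw [e, e2]
    ring

/-- The terms of `[f, ψ]_n` with the coefficients on `ψ` vanish at the endpoint. -/
lemma tendsto_iteratedDeriv_cweight_mul {α β ε γ δ : ℝ} (hε : ε = 1 ∨ ε = -1)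
    (hw : ∀ (k : ℕ) (x : ℝ),
      weight (α + k) (β + k) x = (1 + ε * x) ^ (γ + k) * (1 - ε * x) ^ (δ + k))
    {ψ f : ℝ → ℂ} {r : ℕ} (hψ : ψ =ᶠ[endFilter ε] fun x : ℝ => (1 + (ε : ℂ) * x) ^ r)
    {k i m : ℕ} (hk : k = i + m + 1) {C : ℝ}
    (hf : ∀ x ∈ Ioo (-1 : ℝ) 1, ‖cweight α β m x * iteratedDeriv m f x‖ ≤ C) :
    Tendsto (fun x => iteratedDeriv i (fun y => cweight α β k y * iteratedDeriv k ψ y) x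
      * iteratedDeriv m f x) (endFilter ε) (𝓝 0) := by
  have hs := eventuallyEq_iteratedDeriv hψ k
  rw [iteratedDeriv_one_add_mul_pow] at hs
  have hm : ∀ x ∈ Ioo (-1 : ℝ) 1, 0 < 1 + ε * x ∧ 0 < 1 - ε * x := fun x hx => by
    rcases hε with rfl | rfl <;> constructor <;> linarith [hx.1, hx.2]
  -- For `r < k` the derivative `ψ^(k)` vanishes identically near the endpoint; only `r ≥ k` needs
  -- an estimate.
  rcases lt_or_ge r k with hr | hr
  · have hz : (fun y => cweight α β k y * iteratedDeriv k ψ y) =ᶠ[endFilter ε] fun _ => 0 := by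
      filter_upwards [hs] with x hx
      rw [hx, Nat.descFactorial_of_lt hr]; simp
    refine tendsto_const_nhds.congr' ?_
    filter_upwards [eventuallyEq_iteratedDeriv hz i] with x hx
    rw [hx]; simp
  · set K : ℂ := (ε : ℂ) ^ k * r.descFactorial k with hK
    have hh : ContDiffOn ℝ ∞ (fun x : ℝ => (1 - ε * x) ^ (δ + k)) {x | 0 < 1 - ε * x} :=
      ContDiffOn.rpow_const_of_ne (by fun_prop) fun x hx => (ne_of_gt hx)
    obtain ⟨g, hg, H⟩ := exists_iteratedDeriv_rpow_mul (p := γ + r) hh i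
    have he : (fun y => cweight α β k y * iteratedDeriv k ψ y) =ᶠ[endFilter ε]
        fun y => K * (((1 + ε * y) ^ (γ + r) * (1 - ε * y) ^ (δ + k) : ℝ) : ℂ) := by
      filter_upwards [hs, eventually_endFilter_mem hε] with x hx hI
      have h1 := (hm x hI).1
      have e : (1 + ε * x) ^ (γ + r) = (1 + ε * x) ^ (γ + k) * (1 + ε * x) ^ (r - k) := by
        rw [← Real.rpow_natCast (1 + ε * x) (r - k), ← Real.rpow_add h1]
        congr 1
        push_cast [Nat.cast_sub hr]
        ring
      rw [hx, cweight, hw, e]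
      push_cast
      ring
    -- As `k = i + m + 1`, the exponent `γ + r - i` splits as `(r-k+1) + (γ+m)`. The second part,
    -- with `(1-εx)^(δ+m)` inserted, is `w_m`, which bounds `f^(m)`; the spare power `r-k+1 ≥ 1` in
    -- `u` forces the limit zero.
    let u : ℝ → ℂ := fun x =>
      K * (((1 + ε * x) ^ (r - k + 1) * (g x * ((1 - ε * x) ^ (δ + m))⁻¹) : ℝ) : ℂ)
    have hu : Tendsto u (endFilter ε) (𝓝 0) := by
      have hp : 0 < 1 - ε * (-ε) := by rcases hε with rfl | rfl <;> norm_num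
      have o1 : IsOpen {x : ℝ | 0 < 1 - ε * x} := isOpen_lt (by fun_prop) (by fun_prop)
      have cg : ContinuousAt g (-ε) := hg.continuousOn.continuousAt (o1.mem_nhds hp)
      have cr : ContinuousAt (fun x : ℝ => ((1 - ε * x) ^ (δ + m))⁻¹) (-ε) :=
        ContinuousAt.inv₀ (ContinuousAt.rpow_const (by fun_prop) (Or.inl hp.ne'))
          (Real.rpow_pos_of_pos hp _).ne'
      have cu : ContinuousAt u (-ε) := continuousAt_const.mul
        (Complex.continuous_ofReal.continuousAt.comp
          (ContinuousAt.mul (by fun_prop) (cg.mul cr)))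
      have hu0 : u (-ε) = 0 := by
        have h0 : 1 + ε * (-ε) = 0 := by rcases hε with rfl | rfl <;> norm_num
        simp only [u, h0]
        simp
      have := cu.tendsto.mono_left (endFilter_le ε)
      rwa [hu0] at this
    have hb : Tendsto (fun x => u x * (cweight α β m x * iteratedDeriv m f x)) (endFilter ε)
        (𝓝 0) := by
      refine squeeze_zero_norm' (a := fun x => ‖u x‖ * C) ?_ ?_
      · filter_upwards [eventually_endFilter_mem hε] with x hx
        rw [norm_mul]
        exact mul_le_mul_of_nonneg_left (hf x hx) (norm_nonneg _)
      · simpa using hu.norm.mul_const C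
    refine hb.congr' ?_
    filter_upwards [eventuallyEq_iteratedDeriv he i, eventually_endFilter_mem hε] with x hx hI
    obtain ⟨h1, h2⟩ := hm x hI
    rw [hx, iteratedDeriv_const_mul_field, H x h1 h2, cweight, hw]
    have e : (1 + ε * x) ^ (γ + r - i) = (1 + ε * x) ^ (r - k + 1) * (1 + ε * x) ^ (γ + m) := by
      rw [← Real.rpow_natCast (1 + ε * x) (r - k + 1), ← Real.rpow_add h1]
      congr 1
      push_cast [Nat.cast_sub hr]
      rw [hk]
      push_cast
      ring
    have h3 : ((1 - ε * x) ^ (δ + m)) ≠ 0 := (Real.rpow_pos_of_pos h2 _).ne'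
    have h3' : (((1 - ε * x) ^ (δ + m) : ℝ) : ℂ) ≠ 0 := by exact_mod_cast h3
    rw [e]
    simp only [u]
    push_cast
    field_simp

/-! ### Limits of the quasi-derivatives and of the sesquilinear form. -/

/-- Descending induction from `s = n`: the recursion differentiates the sum for `s + 1`, flips its
sign, and adds the new term `k = s`. -/
lemma quasiDeriv_eq {a : ℕ → ℝ → ℝ} {n : ℕ} {f : ℝ → ℂ}
    (ha : ∀ k, ContDiffOn ℝ ∞ (fun x => (a k x : ℂ)) (Ioo (-1) 1))
    (hf : ContDiffOn ℝ (2 * n - 1 : ℕ) f (Ioo (-1) 1)) {s : ℕ} (hs : 1 ≤ s) (hsn : s ≤ n)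
    {x : ℝ} (hx : x ∈ Ioo (-1 : ℝ) 1) :
    quasiDeriv a n f (2 * n - s) x = ∑ k ∈ Finset.Icc s n, (-1 : ℂ) ^ (k + s) *
      iteratedDeriv (k - s) (fun y => (a k y : ℂ) * iteratedDeriv k f y) x := by
  have hle : ∀ i : ℕ, (i : WithTop ℕ∞) ≤ ∞ := fun i => by exact_mod_cast le_top
  induction hsn using Nat.decreasingInduction generalizing x with
  | self =>
    obtain ⟨m, rfl⟩ : ∃ m, n = m + 1 := ⟨n - 1, by omega⟩
    have : 2 * (m + 1) - (m + 1) = m + 1 := by omega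
    rw [this]
    simp [quasiDeriv, ← two_mul]
  | of_succ s hsn ih =>
    obtain ⟨m, hm⟩ : ∃ m, 2 * n - s = m + 1 := ⟨2 * n - s - 1, by omega⟩
    have hm' : 2 * n - (s + 1) = m := by omega
    have h1 : 2 * n - (m + 1) = s := by omega
    rw [hm'] at ih
    rw [hm, quasiDeriv]
    beta_reduce
    rw [if_neg (by omega), if_neg (by omega), h1]
    have he : quasiDeriv a n f m =ᶠ[𝓝 x] fun x => ∑ k ∈ Finset.Icc (s + 1) n,
        (-1 : ℂ) ^ (k + (s + 1)) *
        iteratedDeriv (k - (s + 1)) (fun y => (a k y : ℂ) * iteratedDeriv k f y) x := by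
      filter_upwards [isOpen_Ioo.mem_nhds hx] with y hy using ih (by omega) hy
    have hd := HasDerivAt.fun_sum (u := Finset.Icc (s + 1) n)
      (A := fun k x => (-1 : ℂ) ^ (k + (s + 1)) *
        iteratedDeriv (k - (s + 1)) (fun y => (a k y : ℂ) * iteratedDeriv k f y) x)
      (A' := fun k => (-1 : ℂ) ^ (k + (s + 1)) *
        iteratedDeriv (k - s) (fun y => (a k y : ℂ) * iteratedDeriv k f y) x) (x := x)
      (fun k hk => by
        rw [Finset.mem_Icc] at hk
        have c : ContDiffOn ℝ (k - s : ℕ) (fun y => (a k y : ℂ) * iteratedDeriv k f y)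
            (Ioo (-1) 1) := ((ha k).of_le (hle _)).mul
          (contDiffOn_iteratedDeriv (hf.of_le (by norm_cast; omega)))
        have := hasDerivAt_iteratedDeriv c (j := k - (s + 1)) (by omega) hx
        rw [show k - (s + 1) + 1 = k - s by omega] at this
        exact this.const_mul _)
    rw [he.deriv_eq, hd.deriv, ← Finset.insert_Icc_add_one_left_eq_Icc hsn.le,
      Finset.sum_insert (by simp), sub_eq_add_neg, ← Finset.sum_neg_distrib]
    congr 1
    · simp [← two_mul]
    · refine Finset.sum_congr rfl fun k _ => ?_
      ring

lemma contDiffOn_jacobiCoeff (α β : ℝ) (c : ℕ → ℝ) (k : ℕ) :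
    ContDiffOn ℝ ∞ (fun x => (jacobiCoeff α β c k x : ℂ)) (Ioo (-1) 1) :=
  Complex.ofRealCLM.contDiff.comp_contDiffOn
    (contDiffOn_const.mul (contDiffOn_weight (α + k) (β + k)))

lemma iteratedDeriv_jacobiCoeff_mul (α β : ℝ) (c : ℕ → ℝ) (k i : ℕ) (u : ℝ → ℂ) (x : ℝ) :
    iteratedDeriv i (fun y => (jacobiCoeff α β c k y : ℂ) * u y) x =
      c k * iteratedDeriv i (fun y => cweight α β k y * u y) x := by
  rw [← iteratedDeriv_const_mul_field]
  congr 2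
  ext y
  simp only [jacobiCoeff, cweight, weight]
  push_cast
  ring

/-- Treats both endpoints at once: `γ` is the exponent of the weight at the endpoint `-ε`, and `δ`
the one at the opposite end. -/
theorem tendsto_quasiDeriv_sesqForm {α β ε γ δ : ℝ} (hα : 0 < α) (hβ : 0 < β)
    (hε : ε = 1 ∨ ε = -1)
    (hw : ∀ (k : ℕ) (x : ℝ),
      weight (α + k) (β + k) x = (1 + ε * x) ^ (γ + k) * (1 - ε * x) ^ (δ + k))
    {n : ℕ} (c : ℕ → ℝ) {f : ℝ → ℂ} (hf : MaxDomain α β n f) {s : ℕ} (hs : 1 ≤ s) (hsn : s ≤ n)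
    {φ : ℝ → ℂ} (hφ : φ =ᶠ[endFilter ε] fun x : ℝ => (1 + (ε : ℂ) * x) ^ (s - 1)) :
    ∃ q : ℂ, Tendsto (quasiDeriv (jacobiCoeff α β c) n f (2 * n - s)) (endFilter ε) (𝓝 q) ∧
      Tendsto (sesqForm (jacobiCoeff α β c) n f φ) (endFilter ε)
        (𝓝 (-((ε : ℂ) ^ (s - 1) * (s - 1).factorial) * q)) := by
  have hC : ContDiffOn ℝ (2 * n - 1 : ℕ) f (Ioo (-1) 1) :=
    ACReg.contDiffOn (hf.acReg.mono (by omega))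
  have hL : ∀ k j : ℕ, ∃ L : ℂ, k ∈ Finset.Icc 1 n → j ∈ Finset.Icc 1 k →
      Tendsto (iteratedDeriv (k - j) (fun y => (jacobiCoeff α β c k y : ℂ) * iteratedDeriv k f y))
        (endFilter ε) (𝓝 L) := by
    intro k j
    by_cases h : k ∈ Finset.Icc 1 n ∧ j ∈ Finset.Icc 1 k
    · obtain ⟨hk, hj⟩ := h
      rw [Finset.mem_Icc] at hk hj
      obtain ⟨k, rfl⟩ : ∃ k', k = k' + 1 := ⟨k - 1, by omega⟩
      obtain ⟨L, hL⟩ := (hf.hasContExt hα hβ (k := k) (i := k + 1 - j) (by omega)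
        (by omega)).tendsto hε
      refine ⟨c (k + 1) * L, fun _ _ => ?_⟩
      simp only [funext (iteratedDeriv_jacobiCoeff_mul α β c (k + 1) (k + 1 - j) _)]
      exact hL.const_mul _
    · exact ⟨0, fun h1 h2 => (h ⟨h1, h2⟩).elim⟩
  choose L hL using hL
  have hψ : conjFun φ =ᶠ[endFilter ε] fun x : ℝ => (1 + (ε : ℂ) * x) ^ (s - 1) := by
    filter_upwards [hφ] with x hx
    simp [conjFun, hx]
  have hB : ∀ m < n, ∃ C : ℝ, ∀ x ∈ Ioo (-1 : ℝ) 1, ‖cweight α β m x * iteratedDeriv m f x‖ ≤ C := by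
    intro m hm
    -- The case `m = 0` lies outside the continuous extension result and uses the growth estimate
    -- for `w f` instead.
    rcases m with _ | m
    · have := hf.hasContExt hα hβ (k := 0) (i := 0) hm le_rfl
      simp only [iteratedDeriv_zero, zero_add, iteratedDeriv_one] at this ⊢
      exact cweight_mul_bounded hα hβ
        (by simpa using hf.differentiableOn 0 (by omega)) this
    · simpa using (hf.hasContExt hα hβ (k := m) (i := 0) (by omega) (by omega)).bounded
  refine ⟨∑ k ∈ Finset.Icc s n, (-1 : ℂ) ^ (k + s) * L k s, ?_, ?_⟩
  · have : Tendsto (fun x => ∑ k ∈ Finset.Icc s n, (-1 : ℂ) ^ (k + s) * iteratedDeriv (k - s)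
        (fun y => (jacobiCoeff α β c k y : ℂ) * iteratedDeriv k f y) x) (endFilter ε)
        (𝓝 (∑ k ∈ Finset.Icc s n, (-1 : ℂ) ^ (k + s) * L k s)) := by
      refine tendsto_finsetSum _ fun k hk => (hL k s ?_ ?_).const_mul _ <;>
        simp only [Finset.mem_Icc] at hk ⊢ <;> omega
    refine this.congr' ?_
    filter_upwards [eventually_endFilter_mem hε] with x hx
    exact (quasiDeriv_eq (contDiffOn_jacobiCoeff α β c) hC hs hsn hx).symm
  · have key : Tendsto (sesqForm (jacobiCoeff α β c) n f φ) (endFilter ε)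
        (𝓝 (∑ k ∈ Finset.Icc 1 n, ∑ j ∈ Finset.Icc 1 k, (-1 : ℂ) ^ (k + j) *
          (0 - L k j * if j - 1 = s - 1 then (ε : ℂ) ^ (s - 1) * (s - 1).factorial else 0))) := by
      refine tendsto_finsetSum _ fun k hk => tendsto_finsetSum _ fun j hj =>
        Tendsto.const_mul _ (Tendsto.sub ?_ ?_)
      · rw [Finset.mem_Icc] at hk hj
        obtain ⟨C, hC⟩ := hB (j - 1) (by omega)
        have := (tendsto_iteratedDeriv_cweight_mul hε hw hψ (k := k) (i := k - j) (m := j - 1)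
          (by omega) hC).const_mul (c k : ℂ)
        rw [mul_zero] at this
        refine this.congr fun x => ?_
        rw [iteratedDeriv_jacobiCoeff_mul, mul_assoc]
      · exact (hL k j hk hj).mul (tendsto_iteratedDeriv_of_eventuallyEq_pow hε hψ (j - 1))
    -- Only `j = s` survives in the inner sum, which requires `k ≥ s`; the truncated equality `j - 1
    -- = s - 1` is faithful since `j, s ≥ 1`.
    convert key using 2
    have hsub : Finset.Icc s n ⊆ Finset.Icc 1 n := Finset.Icc_subset_Icc_left hs
    rw [Finset.mul_sum, ← Finset.sum_subset hsub]
    · refine Finset.sum_congr rfl fun k hk => ?_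
      rw [Finset.mem_Icc] at hk
      rw [Finset.sum_eq_single s]
      · simp only [if_true]; ring
      · intro j hj hne
        rw [Finset.mem_Icc] at hj
        rw [if_neg (by omega)]; simp
      · intro h
        exact (h (Finset.mem_Icc.2 ⟨hs, hk.1⟩)).elim
    · intro k hk hk'
      rw [Finset.mem_Icc] at hk hk'
      refine Finset.sum_eq_zero fun j hj => ?_
      rw [Finset.mem_Icc] at hj
      rw [if_neg (by omega)]; simp

end JacobiPower

theorem mainTheorem8 (α β : ℝ) (hα₀ : 0 < α) (hα₁ : α < 1) (hβ₀ : 0 < β) (hβ₁ : β < 1)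
    (n : ℕ) (c : ℕ → ℝ) (f : ℝ → ℂ) (hf : JacobiPower.MaxDomain α β n f)
    (s : ℕ) (hs₁ : 1 ≤ s) (hsn : s ≤ n) :
    (∀ φ : ℝ → ℂ, JacobiPower.IsPhiPlus s φ →
      ∃ q b : ℂ,
        Tendsto (JacobiPower.quasiDeriv (JacobiPower.jacobiCoeff α β c) n f (2 * n - s))
          (𝓝[<] 1) (𝓝 q) ∧
        Tendsto (JacobiPower.sesqForm (JacobiPower.jacobiCoeff α β c) n f φ) (𝓝[<] 1) (𝓝 b) ∧
        q = (-1) ^ s / ((s - 1).factorial : ℂ) * b) ∧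
    (∀ φ : ℝ → ℂ, JacobiPower.IsPhiMinus s φ →
      ∃ q b : ℂ,
        Tendsto (JacobiPower.quasiDeriv (JacobiPower.jacobiCoeff α β c) n f (2 * n - s))
          (𝓝[>] (-1)) (𝓝 q) ∧
        Tendsto (JacobiPower.sesqForm (JacobiPower.jacobiCoeff α β c) n f φ)
          (𝓝[>] (-1)) (𝓝 b) ∧
        -q = 1 / ((s - 1).factorial : ℂ) * b) := by
  have hfac : ((s - 1).factorial : ℂ) ≠ 0 := by exact_mod_cast (s - 1).factorial_ne_zero
  constructor
  · intro φ hφ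
    have hφ' : φ =ᶠ[JacobiPower.endFilter (-1)]
        fun x : ℝ => (1 + ((-1 : ℝ) : ℂ) * x) ^ (s - 1) := by
      rw [JacobiPower.endFilter_neg_one]
      filter_upwards [hφ.near_one] with x hx
      rw [hx]; push_cast; ring
    obtain ⟨q, hq, hb⟩ := JacobiPower.tendsto_quasiDeriv_sesqForm (γ := α) (δ := β) hα₀ hβ₀
      (Or.inr rfl) (fun k x => by unfold JacobiPower.weight; ring_nf) c hf hs₁ hsn hφ'
    rw [JacobiPower.endFilter_neg_one] at hq hb
    refine ⟨q, _, hq, hb, ?_⟩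
    obtain ⟨r, rfl⟩ : ∃ r, s = r + 1 := ⟨s - 1, by omega⟩
    -- The sign `(-1)^(s-1)` from differentiating `(1-x)^(s-1)` cancels, together with the minus
    -- sign of the form, against `(-1)^s`.
    have h1 : ((-1 : ℂ)) ^ r * (-1) ^ r = 1 := by rw [← mul_pow]; simp
    simp only [Nat.add_sub_cancel] at hfac ⊢
    push_cast
    field_simp
    linear_combination (-q) * h1
  · intro φ hφ
    have hφ' : φ =ᶠ[JacobiPower.endFilter 1]
        fun x : ℝ => (1 + ((1 : ℝ) : ℂ) * x) ^ (s - 1) := by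
      rw [JacobiPower.endFilter_one]
      filter_upwards [hφ.near_neg_one] with x hx
      rw [hx]; push_cast; ring
    obtain ⟨q, hq, hb⟩ := JacobiPower.tendsto_quasiDeriv_sesqForm (γ := β) (δ := α) hα₀ hβ₀
      (Or.inl rfl) (fun k x => by unfold JacobiPower.weight; ring_nf) c hf hs₁ hsn hφ'
    rw [JacobiPower.endFilter_one] at hq hb
    refine ⟨q, _, hq, hb, ?_⟩
    push_cast
    rw [one_pow]
    field_simp
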